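/- Conventions: all spaces are real, $1\le p\le\infty$. A linear lattice homomorphism is a linear map preserving finite suprema and infima. A Banach lattice $X$ is $p$-convex if there is a constant $M\ge 1$ such that $$\Bigl\|\Bigl(\sum_{k=1}^m|x_k|^p\Bigr)^{1/p}\Bigr\|\le M\Bigl(\sum_{k=1}^m\|x_k\|^p\Bigr)^{1/p}\qquad(m\in\mathbb N,\ x_1,\dots,x_m\in X),$$ with maxima in place of the $p$-sums if $p=\infty$; the element on the left is formed with the positively homogeneous continuous function calculus of $X$: $h(x_1,\dots,x_m)=\Phi(h)$, where $\Phi$ is the linear lattice homomorphism into $X$ from the vector lattice of continuous positively homogeneous functions $\mathbb R^m\to\mathbb R$ which maps the $k$-th coordinate function to $x_k$ for each $k$. The least such $M\ge 1$ is the $p$-convexity constant $M^{(p)}(X)$. **Theorem.** Let $E$ be a Banach space and $1\le p\le\infty$. There is a pair $(\mathrm{FBL}^{(p)}[E],\phi_E)$ such that: (i) $\mathrm{FBL}^{(p)}[E]$ is a $p$-convex Banach lattice with $p$-convexity constant $1$, and $\phi_E\colon E\to\mathrm{FBL}^{(p)}[E]$ is a linear isometry (not necessarily onto); (ii) for every $p$-convex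 Banach lattice $X$ and every bounded linear operator $T\colon E\to X$ there is a unique linear lattice homomorphism $\widehat T\colon\mathrm{FBL}^{(p)}[E]\to X$ with $\widehat T\circ\phi_E=T$, and this $\widehat T$ is bounded with $\|\widehat T\|\le M^{(p)}(X)\,\|T\|$. The pair is essentially unique: if $(G,\psi)$ is another pair satisfying (i) and (ii), then there is a unique linear surjective isometry $U\colon\mathrm{FBL}^{(p)}[E]\to G$ that is a lattice homomorphism and satisfies $U\circ\phi_E=\psi$. -/

import Mathlib

open scoped ENNReal

/-- A (real) Banach lattice: a complete normed vector lattice whose norm is a lattice norm,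
that is, `|x| ≤ |y|` implies `‖x‖ ≤ ‖y‖`. -/
class IsBanachLattice (X : Type*) [NormedAddCommGroup X] [NormedSpace ℝ X] [Lattice X] : Prop
    extends IsOrderedAddMonoid X, IsOrderedModule ℝ X, HasSolidNorm X, CompleteSpace X

/-- A linear map between vector lattices is a lattice homomorphism if it preserves finite suprema
and infima. -/
structure IsLatticeHom {X Y : Type*} [AddCommGroup X] [Module ℝ X] [Lattice X]
    [AddCommGroup Y] [Module ℝ Y] [Lattice Y] (T : X →ₗ[ℝ] Y) : Prop where
  map_sup : ∀ x y : X, T (x ⊔ y) = T x ⊔ T y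
  map_inf : ∀ x y : X, T (x ⊓ y) = T x ⊓ T y

/-- The space `𝓗ₘ` of continuous, positively homogeneous, real-valued functions on `ℝᵐ`. -/
def PosHom (m : ℕ) : Submodule ℝ C(Fin m → ℝ, ℝ) where
  carrier := {h | ∀ (c : ℝ) (t : Fin m → ℝ), 0 ≤ c → h (c • t) = c * h t}
  add_mem' := by
    intro f g hf hg c t hc
    simp only [ContinuousMap.add_apply, hf c t hc, hg c t hc]
    ring
  zero_mem' := by
    intro c t _
    simp
  smul_mem' := by
    intro a f hf c t hc
    simp only [ContinuousMap.smul_apply, smul_eq_mul, hf c t hc]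
    ring

/-- `𝓗ₘ` is a vector lattice for the pointwise operations. -/
instance PosHom.instLattice (m : ℕ) : Lattice (PosHom m) :=
  Subtype.lattice
    (fun {f g} hf hg c t hc => by
      simp only [ContinuousMap.sup_apply, hf c t hc, hg c t hc]
      exact (mul_max_of_nonneg _ _ hc).symm)
    (fun {f g} hf hg c t hc => by
      simp only [ContinuousMap.inf_apply, hf c t hc, hg c t hc]
      exact (mul_min_of_nonneg _ _ hc).symm)

/-- The coordinate projection `πₖ(t₁, …, tₘ) = tₖ`, as an element of `𝓗ₘ`. -/
def PosHom.proj {m : ℕ} (k : Fin m) : PosHom m :=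
  ⟨⟨fun t => t k, continuous_apply k⟩, fun _ _ _ => rfl⟩

/-- The `ℓᵖ`-norm `t ↦ (∑ₖ |tₖ|ᵖ)^(1/p)` (`t ↦ maxₖ |tₖ|` if `p = ∞`), as an element of `𝓗ₘ`. -/
noncomputable def PosHom.lpNorm (p : ℝ≥0∞) [Fact (1 ≤ p)] (m : ℕ) : PosHom m :=
  ⟨⟨fun t => ‖(WithLp.toLp p t : PiLp p (fun _ : Fin m => ℝ))‖,
      continuous_norm.comp (PiLp.continuous_toLp p (fun _ : Fin m => ℝ))⟩,
    fun c t hc => by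
      change ‖WithLp.toLp p (c • t)‖ = c * ‖WithLp.toLp p t‖
      rw [WithLp.toLp_smul, norm_smul, Real.norm_of_nonneg hc]⟩

/-- `Φ` is the positively homogeneous continuous function calculus at `x = (x₁, …, xₘ)`, so that
`Φ h` is the element `h(x₁, …, xₘ)`: it is a linear lattice homomorphism `𝓗ₘ → X` that maps `πₖ`
to `xₖ`. (In a Banach lattice there is exactly one such `Φ` for every `x`.) -/
structure IsFunctionCalculus {X : Type*} [AddCommGroup X] [Module ℝ X] [Lattice X] {m : ℕ}
    (x : Fin m → X) (Φ : PosHom m →ₗ[ℝ] X) : Prop where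
  isLatticeHom : IsLatticeHom Φ
  map_proj : ∀ k, Φ (PosHom.proj k) = x k

/-- The inequality `‖(∑ₖ |xₖ|ᵖ)^(1/p)‖ ≤ M (∑ₖ ‖xₖ‖ᵖ)^(1/p)` for all `x₁, …, xₘ ∈ X`, where the
element on the left is formed by means of the function calculus. -/
def PConvexWith (p : ℝ≥0∞) [Fact (1 ≤ p)] (X : Type*) [NormedAddCommGroup X] [NormedSpace ℝ X]
    [Lattice X] (M : ℝ) : Prop :=
  ∀ (m : ℕ) (x : Fin m → X), ∃ Φ : PosHom m →ₗ[ℝ] X, IsFunctionCalculus x Φ ∧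
    ‖Φ (PosHom.lpNorm p m)‖ ≤
      M * ‖(WithLp.toLp p (fun k => ‖x k‖) : PiLp p (fun _ : Fin m => ℝ))‖

/-- `X` is `p`-convex. -/
def IsPConvex (p : ℝ≥0∞) [Fact (1 ≤ p)] (X : Type*) [NormedAddCommGroup X] [NormedSpace ℝ X]
    [Lattice X] : Prop :=
  ∃ M : ℝ, 1 ≤ M ∧ PConvexWith p X M

/-- The `p`-convexity constant `M⁽ᵖ⁾(X)` of a `p`-convex Banach lattice: the least `M ≥ 1` for which
the inequality of `p`-convexity holds. -/
noncomputable def pConvexityConst (p : ℝ≥0∞) [Fact (1 ≤ p)] (X : Type*) [NormedAddCommGroup X]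
    [NormedSpace ℝ X] [Lattice X] : ℝ :=
  sInf {M : ℝ | 1 ≤ M ∧ PConvexWith p X M}

/-- The pair `(F, φ)` is a free `p`-convex Banach lattice over `E`, tested against Banach lattices
in `Type v`. A competitor of the extension `S` in the uniqueness clause is an arbitrary linear
lattice homomorphism, not assumed bounded. -/
structure IsFreePConvex.{v, u, w} (p : ℝ≥0∞) [Fact (1 ≤ p)] {E : Type u} [NormedAddCommGroup E]
    [NormedSpace ℝ E] {F : Type w} [NormedAddCommGroup F] [NormedSpace ℝ F] [Lattice F]
    (φ : E →ₗᵢ[ℝ] F) : Prop where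
  isBanachLattice : IsBanachLattice F
  isPConvex : IsPConvex p F
  pConvexityConst_eq_one : pConvexityConst p F = 1
  exists_unique_extension : ∀ (X : Type v) [NormedAddCommGroup X] [NormedSpace ℝ X] [Lattice X]
    [IsBanachLattice X], IsPConvex p X → ∀ T : E →L[ℝ] X,
      ∃ S : F →L[ℝ] X, IsLatticeHom (S : F →ₗ[ℝ] X) ∧ (∀ x, S (φ x) = T x) ∧
        ‖S‖ ≤ pConvexityConst p X * ‖T‖ ∧
        ∀ S' : F →ₗ[ℝ] X, IsLatticeHom S' → (∀ x, S' (φ x) = T x) → S' = (S : F →ₗ[ℝ] X)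

universe u v

/-!
# Existence and uniqueness of the free `p`-convex Banach lattice

The free object is realized inside a product. Take all contractions `T : E → X_T` into Banach
lattices with `p`-convexity constant `1`, form the `ℓ^∞`-product of the `X_T`, and let `F` be the
closed sublattice generated by the points `(T x)_T`, `x ∈ E`. The coordinate `F → X_T` extends `T`,
it is contractive, and it is determined by `T` because lattice homomorphisms between Banach lattices
are automatically bounded (`IsLatticeHom.exists_bound`). The following facts make this work.

* *Uniqueness of the function calculus* (`IsFunctionCalculus.unique`). By the lattice version of the
  Stone–Weierstrass theorem the vector lattice generated by the coordinates is dense in `𝓗ₘ`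
  relative to the order unit `∑ₖ |πₖ|`, and a lattice homomorphism is continuous for that unit. The
  same argument shows that closed sublattices are stable under the calculus, hence inherit
  `p`-convexity with the same constant; for `ℓ^∞`-products the calculus is formed coordinatewise.
* *Renorming* (`PConvexWith.exists_renorming`). If `X` is `p`-convex with constant `M`, then
  `N(y) = inf {(∑ₖ ‖xₖ‖ᵖ)^(1/p) : |y| ≤ (∑ₖ |xₖ|ᵖ)^(1/p)}` is a lattice norm with `p`-convexity
  constant `1` and `N ≤ ‖·‖ ≤ M N`. Both `p`-convexity and the triangle inequality come from
  concatenating the tuples that dominate the given elements (`PDominated.lpNorm`). This reduces the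
  bound `‖T̂‖ ≤ M‖T‖` to contractions into lattices with constant `1`.
* *Smallness*. The points of the closed sublattice generated by a map on `E` are limits of sequences
  of formal lattice expressions over `E`, so the lattice has a copy in the universe of `E`
  (`small_latticeSpan`). It therefore suffices to take targets `X_T` in that universe, and `F`
  itself can be moved there.

That `E → F` is isometric follows from the norming functionals, as `ℝ` is one of the targets.
-/

universe w

/-! ### Lattice homomorphisms -/

namespace IsLatticeHom

variable {X Y Z : Type*} [AddCommGroup X] [Module ℝ X] [Lattice X]
  [AddCommGroup Y] [Module ℝ Y] [Lattice Y] [AddCommGroup Z] [Module ℝ Z] [Lattice Z]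
  {T : X →ₗ[ℝ] Y}

theorem monotone (hT : IsLatticeHom T) : Monotone T := fun x y h => by
  rw [← sup_eq_right] at h ⊢
  rw [← hT.map_sup, h]

theorem map_abs (hT : IsLatticeHom T) (x : X) : T |x| = |T x| := by
  simp only [abs, hT.map_sup, map_neg]

theorem comp {S : Y →ₗ[ℝ] Z} (hS : IsLatticeHom S) (hT : IsLatticeHom T) :
    IsLatticeHom (S ∘ₗ T) where
  map_sup x y := by simp [hT.map_sup, hS.map_sup]
  map_inf x y := by simp [hT.map_inf, hS.map_inf]

end IsLatticeHom

/-! ### The lattice of positively homogeneous functions -/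

namespace PosHom

variable {m n : ℕ}

instance : CoeFun (PosHom m) (fun _ => (Fin m → ℝ) → ℝ) := ⟨fun h => h.1⟩

@[ext] theorem ext {f g : PosHom m} (h : ∀ t, f t = g t) : f = g :=
  Subtype.ext (ContinuousMap.ext h)

theorem map_smul_of_nonneg (h : PosHom m) {c : ℝ} (hc : 0 ≤ c) (t : Fin m → ℝ) :
    h (c • t) = c * h t := h.2 c t hc

@[simp] theorem map_zero (h : PosHom m) : h 0 = 0 := by
  simpa using map_smul_of_nonneg h le_rfl 0

@[simp] theorem add_apply (f g : PosHom m) (t : Fin m → ℝ) : (f + g) t = f t + g t := rfl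
@[simp] theorem sub_apply (f g : PosHom m) (t : Fin m → ℝ) : (f - g) t = f t - g t := rfl
@[simp] theorem zero_apply (t : Fin m → ℝ) : (0 : PosHom m) t = 0 := rfl
@[simp] theorem smul_apply (c : ℝ) (f : PosHom m) (t : Fin m → ℝ) : (c • f) t = c * f t := rfl
@[simp] theorem sup_apply (f g : PosHom m) (t : Fin m → ℝ) : (f ⊔ g) t = f t ⊔ g t := rfl
@[simp] theorem inf_apply (f g : PosHom m) (t : Fin m → ℝ) : (f ⊓ g) t = f t ⊓ g t := rfl
@[simp] theorem abs_apply (f : PosHom m) (t : Fin m → ℝ) : |f| t = |f t| := rfl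
@[simp] theorem proj_apply (k : Fin m) (t : Fin m → ℝ) : proj k t = t k := rfl

theorem lpNorm_apply (p : ℝ≥0∞) [Fact (1 ≤ p)] (t : Fin m → ℝ) :
    lpNorm p m t = ‖(WithLp.toLp p t : PiLp p (fun _ : Fin m => ℝ))‖ := rfl

@[simp] theorem sum_apply {ι : Type*} (s : Finset ι) (f : ι → PosHom m) (t : Fin m → ℝ) :
    (∑ i ∈ s, f i) t = ∑ i ∈ s, f i t := by
  induction s using Finset.cons_induction with
  | empty => simp
  | cons a s ha ih => simp [Finset.sum_cons]

theorem le_def {f g : PosHom m} : f ≤ g ↔ ∀ t, f t ≤ g t := Iff.rfl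

/-- Substitution of the positively homogeneous functions `h₁, …, hₙ` into functions of `n`
variables: `g ↦ g(h₁, …, hₙ)`. -/
def subst (h : Fin n → PosHom m) : PosHom n →ₗ[ℝ] PosHom m where
  toFun g := ⟨⟨fun t => g fun j => h j t,
      g.1.continuous.comp (continuous_pi fun j => (h j).1.continuous)⟩, fun c t hc => by
    change g (fun j => h j (c • t)) = c * g fun j => h j t
    simp only [map_smul_of_nonneg _ hc]
    exact map_smul_of_nonneg g hc _⟩
  map_add' _ _ := rfl
  map_smul' _ _ := rfl

@[simp] theorem subst_apply (h : Fin n → PosHom m) (g : PosHom n) (t : Fin m → ℝ) :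
    subst h g t = g fun j => h j t := rfl

theorem isLatticeHom_subst (h : Fin n → PosHom m) : IsLatticeHom (subst h) where
  map_sup _ _ := rfl
  map_inf _ _ := rfl

/-- By homogeneity, a bound on the unit sphere of the maximum norm gives a bound by a multiple of
the larger `ℓ¹`-norm. -/
theorem abs_le_smul_of_sphere {h : PosHom m} {C : ℝ} (hC : 0 ≤ C)
    (H : ∀ t : Fin m → ℝ, ‖t‖ = 1 → |h t| ≤ C) : |h| ≤ C • ∑ k, |proj k| := by
  refine le_def.2 fun t => ?_
  have hle : ‖t‖ ≤ ∑ k, |t k| := (pi_norm_le_iff_of_nonneg (by positivity)).2 fun k => by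
    simpa using Finset.single_le_sum (f := fun k => |t k|) (fun _ _ => abs_nonneg _)
      (Finset.mem_univ k)
  rcases eq_or_ne t 0 with rfl | ht
  · simp
  have hn : 0 < ‖t‖ := norm_pos_iff.2 ht
  have h1 : |h (‖t‖⁻¹ • t)| ≤ C := H _ (by simp [norm_smul, hn.ne'])
  have h2 : h t = ‖t‖ * h (‖t‖⁻¹ • t) := by
    rw [← map_smul_of_nonneg h hn.le, smul_smul, mul_inv_cancel₀ hn.ne', one_smul]
  rw [abs_apply, h2, abs_mul, abs_of_pos hn, mul_comm]
  simp only [smul_apply, sum_apply, abs_apply, proj_apply]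
  exact mul_le_mul h1 hle hn.le hC

/-- Every positively homogeneous continuous function is dominated by a multiple of the
`ℓ¹`-norm. -/
theorem exists_abs_le (h : PosHom m) : ∃ C : ℝ, 0 ≤ C ∧ |h| ≤ C • ∑ k, |proj k| := by
  obtain ⟨C, hC⟩ := (isCompact_sphere (0 : Fin m → ℝ) 1).exists_bound_of_continuousOn
    h.1.continuous.continuousOn
  exact ⟨max C 0, le_max_right _ _, abs_le_smul_of_sphere (le_max_right _ _) fun t ht =>
    (hC t (by simpa using ht)).trans (le_max_left _ _)⟩

/-- Two distinct points of the unit sphere are separated by a member of any vector lattice of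
functions that contains the coordinates. -/
theorem exists_eq_one_eq_zero (L : Submodule ℝ (PosHom m)) (hsup : ∀ f ∈ L, ∀ g ∈ L, f ⊔ g ∈ L)
    (hproj : ∀ k, proj k ∈ L) {x y : Fin m → ℝ} (hx : ‖x‖ = 1) (hy : ‖y‖ = 1) (hxy : x ≠ y) :
    ∃ g ∈ L, g x = 1 ∧ g y = 0 := by
  obtain ⟨k, hk⟩ : ∃ k, x k ≠ 0 := by
    by_contra! h
    rw [funext h] at hx
    simp [show (fun _ => 0 : Fin m → ℝ) = 0 from rfl] at hx
  -- Normalize a coordinate at `x`. If it is not positive at `y`, take its positive part; otherwise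
  -- correct another coordinate by a multiple of it.
  set a : PosHom m := (x k)⁻¹ • proj k with ha
  have haL : a ∈ L := L.smul_mem _ (hproj k)
  have hax : a x = 1 := by simp [ha, hk]
  rcases le_or_gt (a y) 0 with hc | hc
  · exact ⟨a ⊔ 0, hsup _ haL _ L.zero_mem, by simp [hax], by simp [hc]⟩
  obtain ⟨l, hl⟩ : ∃ l, a y * x l ≠ y l := by
    by_contra! h
    have hyx : y = a y • x := funext fun l => (h l).symm
    have h1 : a y = 1 := by
      have := congrArg norm hyx
      rw [norm_smul, hx, hy, Real.norm_of_nonneg hc.le] at this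
      linarith
    exact hxy (by rw [hyx, h1, one_smul])
  have hne : a y * x l - y l ≠ 0 := sub_ne_zero.2 hl
  refine ⟨(a y * x l - y l)⁻¹ • (a y • proj l - y l • a), L.smul_mem _ (L.sub_mem
    (L.smul_mem _ (hproj l)) (L.smul_mem _ haL)), ?_, ?_⟩
  · simp only [smul_apply, sub_apply, proj_apply, hax, mul_one]
    exact inv_mul_cancel₀ hne
  · simp only [smul_apply, sub_apply, proj_apply]
    ring

/-- A lattice version of the Stone–Weierstrass theorem: a vector sublattice of `𝓗ₘ` that contains
the coordinates is dense, relative to the `ℓ¹`-norm as order unit. -/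
theorem exists_abs_sub_le (L : Submodule ℝ (PosHom m)) (hsup : ∀ f ∈ L, ∀ g ∈ L, f ⊔ g ∈ L)
    (hinf : ∀ f ∈ L, ∀ g ∈ L, f ⊓ g ∈ L) (hproj : ∀ k, proj k ∈ L) (h : PosHom m) {ε : ℝ}
    (hε : 0 < ε) : ∃ g ∈ L, |h - g| ≤ ε • ∑ k, |proj k| := by
  let K := Metric.sphere (0 : Fin m → ℝ) 1
  let r : PosHom m → C(K, ℝ) := fun f => f.1.restrict K
  have hnorm : ∀ x : K, ‖(x : Fin m → ℝ)‖ = 1 := fun x => by simp [K]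
  have hdense : closure (r '' L) = ⊤ := by
    refine ContinuousMap.sublattice_closure_eq_top _ ⟨r 0, 0, L.zero_mem, rfl⟩ ?_ ?_ ?_
    · rintro _ ⟨f, hf, rfl⟩ _ ⟨g, hg, rfl⟩
      exact ⟨f ⊓ g, hinf f hf g hg, rfl⟩
    · rintro _ ⟨f, hf, rfl⟩ _ ⟨g, hg, rfl⟩
      exact ⟨f ⊔ g, hsup f hf g hg, rfl⟩
    · intro v x y
      rcases eq_or_ne x y with rfl | hxy
      · obtain ⟨k, hk⟩ : ∃ k, (x : Fin m → ℝ) k ≠ 0 := by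
          by_contra! h0
          have := hnorm x
          rw [funext h0] at this
          simp [show (fun _ => 0 : Fin m → ℝ) = 0 from rfl] at this
        have : (v x / (x : Fin m → ℝ) k) * (x : Fin m → ℝ) k = v x := div_mul_cancel₀ _ hk
        exact ⟨r ((v x / (x : Fin m → ℝ) k) • proj k), ⟨_, L.smul_mem _ (hproj k), rfl⟩,
          this, this⟩
      · have hxy' : (x : Fin m → ℝ) ≠ y := fun e => hxy (Subtype.ext e)
        obtain ⟨f, hf, fx, fy⟩ := exists_eq_one_eq_zero L hsup hproj (hnorm x) (hnorm y) hxy'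
        obtain ⟨g, hg, gy, gx⟩ :=
          exists_eq_one_eq_zero L hsup hproj (hnorm y) (hnorm x) hxy'.symm
        refine ⟨r (v x • f + v y • g), ⟨_, L.add_mem (L.smul_mem _ hf) (L.smul_mem _ hg), rfl⟩,
          ?_, ?_⟩
        · change v x * f x + v y * g x = v x
          rw [fx, gx]; ring
        · change v x * f y + v y * g y = v y
          rw [fy, gy]; ring
  have hmem : r h ∈ closure (r '' L) := by rw [hdense]; trivial
  obtain ⟨_, ⟨g, hg, rfl⟩, hd⟩ := Metric.mem_closure_iff.1 hmem ε hε
  refine ⟨g, hg, abs_le_smul_of_sphere hε.le fun t ht => ?_⟩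
  exact (ContinuousMap.dist_apply_le_dist (f := r h) (g := r g)
    ⟨t, by simpa [K] using ht⟩).trans hd.le

end PosHom

/-! ### The positively homogeneous function calculus -/

namespace IsFunctionCalculus

variable {X Y : Type*} [NormedAddCommGroup X] [NormedSpace ℝ X] [Lattice X]
  [NormedAddCommGroup Y] [NormedSpace ℝ Y] [Lattice Y]
  {m n : ℕ} {x : Fin m → X} {Φ Ψ : PosHom m →ₗ[ℝ] X}

theorem map {T : X →ₗ[ℝ] Y} (hT : IsLatticeHom T) (hΦ : IsFunctionCalculus x Φ) :
    IsFunctionCalculus (fun k => T (x k)) (T ∘ₗ Φ) where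
  isLatticeHom := hT.comp hΦ.isLatticeHom
  map_proj k := by simp [hΦ.map_proj]

theorem subst (hΦ : IsFunctionCalculus x Φ) (h : Fin n → PosHom m) :
    IsFunctionCalculus (fun j => Φ (h j)) (Φ ∘ₗ PosHom.subst h) where
  isLatticeHom := hΦ.isLatticeHom.comp (PosHom.isLatticeHom_subst h)
  map_proj _ := rfl

variable [IsBanachLattice X]

theorem norm_le (hΦ : IsFunctionCalculus x Φ) {h : PosHom m} {C : ℝ} (hC : 0 ≤ C)
    (hh : |h| ≤ C • ∑ k, |PosHom.proj k|) : ‖Φ h‖ ≤ C * ∑ k, ‖x k‖ := by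
  have h1 : |Φ h| ≤ |C • ∑ k, (|x k|)| := by
    refine le_trans ?_ (le_abs_self _)
    have := hΦ.isLatticeHom.monotone hh
    simpa only [hΦ.isLatticeHom.map_abs, map_smul, map_sum, hΦ.map_proj] using this
  calc ‖Φ h‖ ≤ ‖C • ∑ k, (|x k|)‖ := norm_le_norm_of_abs_le_abs h1
    _ ≤ C * ∑ k, ‖x k‖ := by
      rw [norm_smul, Real.norm_of_nonneg hC]
      gcongr
      exact (norm_sum_le _ _).trans (by simp only [norm_abs_eq_norm, le_refl])

/-- A closed vector sublattice is stable under the function calculus. -/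
theorem mem_of_isClosed (hΦ : IsFunctionCalculus x Φ) (S : Submodule ℝ X)
    (hS : IsClosed (S : Set X)) (hsup : ∀ a ∈ S, ∀ b ∈ S, a ⊔ b ∈ S)
    (hinf : ∀ a ∈ S, ∀ b ∈ S, a ⊓ b ∈ S) (hx : ∀ k, x k ∈ S) (h : PosHom m) : Φ h ∈ S := by
  rw [← SetLike.mem_coe, ← hS.closure_eq, Metric.mem_closure_iff]
  intro ε hε
  have hpos : 0 < ∑ k, ‖x k‖ + 1 := by positivity
  obtain ⟨g, hg, hle⟩ := PosHom.exists_abs_sub_le (S.comap Φ)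
    (fun f hf g hg => by
      rw [Submodule.mem_comap, hΦ.isLatticeHom.map_sup]; exact hsup _ hf _ hg)
    (fun f hf g hg => by
      rw [Submodule.mem_comap, hΦ.isLatticeHom.map_inf]; exact hinf _ hf _ hg)
    (fun k => by rw [Submodule.mem_comap, hΦ.map_proj]; exact hx k) h (div_pos hε hpos)
  refine ⟨Φ g, hg, ?_⟩
  rw [dist_eq_norm, ← map_sub]
  refine (hΦ.norm_le (div_pos hε hpos).le hle).trans_lt ?_
  rw [div_mul_eq_mul_div, div_lt_iff₀ hpos]
  nlinarith

/-- The function calculus at a given tuple is unique. -/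
theorem unique (hΦ : IsFunctionCalculus x Φ) (hΨ : IsFunctionCalculus x Ψ) : Φ = Ψ := by
  ext1 h
  rw [← sub_eq_zero, ← norm_le_zero_iff]
  refine le_of_forall_pos_le_add fun ε hε => ?_
  have hpos : 0 < 2 * (∑ k, ‖x k‖) + 1 := by positivity
  have hε' := div_pos hε hpos
  obtain ⟨g, hg, hle⟩ := PosHom.exists_abs_sub_le (LinearMap.eqLocus Φ Ψ)
    (fun f hf g hg => by
      rw [LinearMap.mem_eqLocus] at *
      rw [hΦ.isLatticeHom.map_sup, hΨ.isLatticeHom.map_sup, hf, hg])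
    (fun f hf g hg => by
      rw [LinearMap.mem_eqLocus] at *
      rw [hΦ.isLatticeHom.map_inf, hΨ.isLatticeHom.map_inf, hf, hg])
    (fun k => by rw [LinearMap.mem_eqLocus, hΦ.map_proj, hΨ.map_proj]) h hε'
  have hg' : Φ g = Ψ g := hg
  have e : Φ h - Ψ h = Φ (h - g) - Ψ (h - g) := by rw [map_sub, map_sub, hg']; abel
  rw [e, zero_add]
  refine (norm_sub_le _ _).trans
    ((add_le_add (hΦ.norm_le hε'.le hle) (hΨ.norm_le hε'.le hle)).trans ?_)
  rw [div_mul_eq_mul_div, ← add_div, div_le_iff₀ hpos]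
  nlinarith

/-- Substitution rule: `g(h₁(x), …, hₙ(x)) = (g ∘ h)(x)`. -/
theorem apply_eq_subst (hΦ : IsFunctionCalculus x Φ) (h : Fin n → PosHom m) {y : Fin n → X}
    (hy : ∀ j, y j = Φ (h j)) {Θ : PosHom n →ₗ[ℝ] X} (hΘ : IsFunctionCalculus y Θ)
    (g : PosHom n) : Θ g = Φ (PosHom.subst h g) := by
  obtain rfl : y = fun j => Φ (h j) := funext hy
  rw [hΘ.unique (hΦ.subst h)]
  rfl

end IsFunctionCalculus

/-! ### Identities and inequalities for the `ℓᵖ`-norm -/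

namespace PosHom

variable {p : ℝ≥0∞} [hp : Fact (1 ≤ p)] {m n : ℕ}

theorem lpNorm_mono {s t : Fin m → ℝ} (h : ∀ k, |s k| ≤ |t k|) :
    lpNorm p m s ≤ lpNorm p m t := by
  simp only [lpNorm_apply]
  rcases p.dichotomy with rfl | h1
  · simp only [PiLp.norm_eq_ciSup, Real.norm_eq_abs]
    exact Real.iSup_le (fun k => (h k).trans
      (le_ciSup (f := fun k => |t k|) (Set.finite_range _).bddAbove k))
      (Real.iSup_nonneg fun _ => abs_nonneg _)
  · have h0 : 0 < p.toReal := by linarith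
    simp only [PiLp.norm_eq_sum h0, Real.norm_eq_abs]
    exact Real.rpow_le_rpow (by positivity) (Finset.sum_le_sum fun k _ =>
      Real.rpow_le_rpow (abs_nonneg _) (h k) h0.le) (by positivity)

theorem lpNorm_nonneg (t : Fin m → ℝ) : 0 ≤ lpNorm p m t := by
  rw [lpNorm_apply]
  exact norm_nonneg _

theorem lpNorm_abs (t : Fin m → ℝ) : lpNorm p m (fun k => |t k|) = lpNorm p m t :=
  le_antisymm (lpNorm_mono fun _ => (abs_abs _).le) (lpNorm_mono fun _ => (abs_abs _).ge)

theorem lpNorm_smul (c : ℝ) (t : Fin m → ℝ) :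
    lpNorm p m (fun k => c * t k) = |c| * lpNorm p m t := by
  rw [lpNorm_apply, lpNorm_apply, ← Real.norm_eq_abs, ← norm_smul]
  rfl

theorem lpNorm_one (t : Fin 1 → ℝ) : lpNorm p 1 t = |t 0| := by
  rw [lpNorm_apply]
  rcases p.dichotomy with rfl | h1
  · simp [PiLp.norm_eq_ciSup]
  · have h0 : 0 < p.toReal := by linarith
    simp only [PiLp.norm_eq_sum h0, Finset.univ_unique, Fin.default_eq_zero, Finset.sum_singleton,
      Real.norm_eq_abs]
    rw [one_div, Real.rpow_rpow_inv (abs_nonneg _) h0.ne']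

/-- The `ℓᵖ`-norm of a concatenation of tuples is the `ℓᵖ`-norm of their `ℓᵖ`-norms. -/
theorem lpNorm_sigma {m : Fin n → ℕ} (t : Fin (∑ j, m j) → ℝ) :
    lpNorm p (∑ j, m j) t =
      lpNorm p n fun j => lpNorm p (m j) fun i => t (finSigmaFinEquiv ⟨j, i⟩) := by
  simp only [lpNorm_apply]
  rw [← (LinearIsometryEquiv.piLpCongrLeft p ℝ ℝ
      (finSigmaFinEquiv (n := m)).symm).norm_map (WithLp.toLp p t),
    ← (LinearIsometryEquiv.piLpCurry ℝ p fun (j : Fin n) (_ : Fin (m j)) => ℝ).norm_map]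
  rcases p.dichotomy with rfl | h1
  · simp only [PiLp.norm_eq_ciSup]
    simp only [abs_of_nonneg (Real.iSup_nonneg fun _ => abs_nonneg _), Real.norm_eq_abs]
    rfl
  · have h0 : 0 < p.toReal := by linarith
    simp only [PiLp.norm_eq_sum h0, Real.norm_eq_abs]
    simp only [abs_of_nonneg (Real.rpow_nonneg (Finset.sum_nonneg
      fun _ _ => Real.rpow_nonneg (abs_nonneg _) _) _)]
    rfl

/-- The weights for which convex combinations are dominated by `ℓᵖ`-sums: this is the convexity
of `t ↦ tᵖ`. For `p = ∞` the exponent `1 / p.toReal` is `0` and all weights are `1`. -/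
theorem convexComb_le_lpNorm {a b : ℝ} (ha : 0 ≤ a) (hb : 0 ≤ b) (hab : a + b = 1) (s t : ℝ) :
    a * |s| + b * |t| ≤
      lpNorm p 2 ![a ^ (1 / p.toReal) * s, b ^ (1 / p.toReal) * t] := by
  rw [lpNorm_apply]
  rcases p.dichotomy with rfl | h1
  · have h1 := PiLp.norm_apply_le (p := ∞) (WithLp.toLp ∞ ![s, t]) 0
    have h2 := PiLp.norm_apply_le (p := ∞) (WithLp.toLp ∞ ![s, t]) 1
    simp only [ENNReal.toReal_top, div_zero, Real.rpow_zero, one_mul]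
    simp only [Matrix.cons_val_zero, Matrix.cons_val_one, Real.norm_eq_abs] at h1 h2
    exact (add_le_add (mul_le_mul_of_nonneg_left h1 ha)
      (mul_le_mul_of_nonneg_left h2 hb)).trans_eq (by rw [← add_mul, hab, one_mul])
  · have h0 : 0 < p.toReal := by linarith
    have key := Real.rpow_arith_mean_le_arith_mean_rpow Finset.univ ![a, b] ![|s|, |t|]
      (by simp [Fin.forall_fin_two, ha, hb]) (by simp [hab]) (by simp [Fin.forall_fin_two]) h1
    have hpow : ∀ c : ℝ, 0 ≤ c → ∀ r : ℝ,
        ‖c ^ (1 / p.toReal) * r‖ ^ p.toReal = c * |r| ^ p.toReal := by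
      intro c hc r
      rw [norm_mul, Real.norm_of_nonneg (by positivity),
        Real.mul_rpow (by positivity) (by positivity), one_div,
        Real.rpow_inv_rpow hc h0.ne', Real.norm_eq_abs]
    rw [PiLp.norm_eq_sum h0, Fin.sum_univ_two, one_div p.toReal,
      Real.le_rpow_inv_iff_of_pos (by positivity) (by positivity) h0]
    simp only [Fin.sum_univ_two, Matrix.cons_val_zero, Matrix.cons_val_one] at key ⊢
    rwa [← one_div, hpow a ha, hpow b hb]

theorem lpNorm_weights {a b : ℝ} (ha : 0 ≤ a) (hb : 0 ≤ b) (hab : a + b = 1) :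
    lpNorm p 2 ![a ^ (1 / p.toReal), b ^ (1 / p.toReal)] ≤ 1 := by
  rw [lpNorm_apply]
  rcases p.dichotomy with rfl | h1
  · rw [PiLp.norm_eq_ciSup]
    exact ciSup_le fun k => by fin_cases k <;> simp
  · have h0 : 0 < p.toReal := by linarith
    have hpow : ∀ c : ℝ, 0 ≤ c → ‖c ^ (1 / p.toReal)‖ ^ p.toReal = c := by
      intro c hc
      rw [Real.norm_of_nonneg (by positivity), one_div, Real.rpow_inv_rpow hc h0.ne']
    rw [PiLp.norm_eq_sum h0, Fin.sum_univ_two]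
    simp only [Matrix.cons_val_zero, Matrix.cons_val_one, hpow a ha, hpow b hb, hab,
      Real.one_rpow, le_refl]

end PosHom

/-! ### Elements dominated by `p`-sums -/

theorem abs_smul_le_smul_abs {X : Type*} [AddCommGroup X] [Module ℝ X] [Lattice X]
    [IsOrderedAddMonoid X] [IsOrderedModule ℝ X] (c : ℝ) (x : X) : |c • x| ≤ |c| • |x| := by
  rcases le_total 0 c with hc | hc
  · rw [abs_of_nonneg hc]
    refine abs_le'.2 ⟨smul_le_smul_of_nonneg_left (le_abs_self x) hc, ?_⟩
    rw [← smul_neg]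
    exact smul_le_smul_of_nonneg_left (neg_le_abs x) hc
  · rw [abs_of_nonpos hc]
    refine abs_le'.2 ⟨?_, ?_⟩
    · rw [← neg_smul_neg]
      exact smul_le_smul_of_nonneg_left (neg_le_abs x) (neg_nonneg.2 hc)
    · rw [← neg_smul]
      exact smul_le_smul_of_nonneg_left (le_abs_self x) (neg_nonneg.2 hc)

/-- Every finite tuple in `X` admits a positively homogeneous function calculus. -/
def HasFunctionCalculus (X : Type*) [AddCommGroup X] [Module ℝ X] [Lattice X] : Prop :=
  ∀ (m : ℕ) (x : Fin m → X), ∃ Φ : PosHom m →ₗ[ℝ] X, IsFunctionCalculus x Φ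

namespace HasFunctionCalculus

/-- The function calculus at the tuple `x`. -/
noncomputable def eval {X : Type*} [AddCommGroup X] [Module ℝ X] [Lattice X]
    (hX : HasFunctionCalculus X) {m : ℕ} (x : Fin m → X) : PosHom m →ₗ[ℝ] X :=
  (hX m x).choose

theorem isFunctionCalculus {X : Type*} [AddCommGroup X] [Module ℝ X] [Lattice X]
    (hX : HasFunctionCalculus X) {m : ℕ} (x : Fin m → X) : IsFunctionCalculus x (hX.eval x) :=
  (hX m x).choose_spec

variable {X : Type*} [NormedAddCommGroup X] [NormedSpace ℝ X] [Lattice X]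
  (hX : HasFunctionCalculus X) {p : ℝ≥0∞} [hp : Fact (1 ≤ p)] {m n : ℕ}

theorem eval_proj (x : Fin m → X) (k : Fin m) : hX.eval x (PosHom.proj k) = x k :=
  (hX.isFunctionCalculus x).map_proj k

theorem eval_mono (x : Fin m → X) {g h : PosHom m} (hgh : ∀ t, g t ≤ h t) :
    hX.eval x g ≤ hX.eval x h :=
  (hX.isFunctionCalculus x).isLatticeHom.monotone (PosHom.le_def.2 hgh)

theorem eval_abs (x : Fin m → X) (g : PosHom m) : hX.eval x |g| = |hX.eval x g| :=
  (hX.isFunctionCalculus x).isLatticeHom.map_abs g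

theorem eval_lpNorm_nonneg (x : Fin m → X) : 0 ≤ hX.eval x (PosHom.lpNorm p m) := by
  have := hX.eval_mono x (g := 0) (h := PosHom.lpNorm p m) PosHom.lpNorm_nonneg
  rwa [map_zero] at this

/-- `y` is dominated by a `p`-sum `(∑ₖ |xₖ|ᵖ)^(1/p)` with `(∑ₖ ‖xₖ‖ᵖ)^(1/p) ≤ b`. -/
def PDominated (p : ℝ≥0∞) [Fact (1 ≤ p)] (y : X) (b : ℝ) : Prop :=
  ∃ (m : ℕ) (x : Fin m → X), PosHom.lpNorm p m (fun k => ‖x k‖) ≤ b ∧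
    |y| ≤ hX.eval x (PosHom.lpNorm p m)

variable {hX} in
theorem PDominated.mono {y z : X} {b c : ℝ} (h : hX.PDominated p y b) (hyz : |z| ≤ |y|)
    (hbc : b ≤ c) : hX.PDominated p z c := by
  obtain ⟨m, x, hx, hy⟩ := h
  exact ⟨m, x, hx.trans hbc, hyz.trans hy⟩

variable {hX} in
theorem PDominated.nonneg {y : X} {b : ℝ} (h : hX.PDominated p y b) : 0 ≤ b := by
  obtain ⟨m, x, hx, -⟩ := h
  exact (PosHom.lpNorm_nonneg _).trans hx

variable {hX} in
theorem pDominated_norm (y : X) : hX.PDominated p y ‖y‖ := by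
  refine ⟨1, fun _ => y, ?_, ?_⟩
  · simp [PosHom.lpNorm_one]
  · have e : PosHom.lpNorm p 1 = |PosHom.proj 0| := PosHom.ext fun t => PosHom.lpNorm_one t
    rw [e, eval_abs, eval_proj]

variable [IsBanachLattice X]

theorem eval_eq_subst (x : Fin m → X) (h : Fin n → PosHom m) {y : Fin n → X}
    (hy : ∀ j, y j = hX.eval x (h j)) (g : PosHom n) :
    hX.eval y g = hX.eval x (PosHom.subst h g) :=
  (hX.isFunctionCalculus x).apply_eq_subst h hy (hX.isFunctionCalculus y) g

theorem eval_lpNorm_abs (x : Fin m → X) :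
    hX.eval (fun k => |x k|) (PosHom.lpNorm p m) = hX.eval x (PosHom.lpNorm p m) := by
  rw [hX.eval_eq_subst x (fun k => |PosHom.proj k|) fun k => by rw [eval_abs, eval_proj]]
  congr 1
  ext t
  simpa using PosHom.lpNorm_abs t

theorem eval_lpNorm_mono {a u : Fin n → X} (h : ∀ j, |a j| ≤ |u j|) :
    hX.eval a (PosHom.lpNorm p n) ≤ hX.eval u (PosHom.lpNorm p n) := by
  -- Both sides are functions of the `2n` elements `a`, `u`, and `|a j| = |a j| ⊓ |u j|`.
  have ha : ∀ j, hX.eval (Fin.append a u) (PosHom.proj (Fin.castAdd n j)) = a j := fun j => by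
    rw [eval_proj, Fin.append_left]
  have hu : ∀ j, hX.eval (Fin.append a u) (PosHom.proj (Fin.natAdd n j)) = u j := fun j => by
    rw [eval_proj, Fin.append_right]
  rw [← eval_lpNorm_abs hX a, hX.eval_eq_subst (Fin.append a u)
      (fun j => |PosHom.proj (Fin.castAdd n j)| ⊓ |PosHom.proj (Fin.natAdd n j)|) fun j => by
        rw [(hX.isFunctionCalculus _).isLatticeHom.map_inf, eval_abs, eval_abs, ha, hu,
          inf_eq_left.2 (h j)],
    hX.eval_eq_subst (Fin.append a u) (fun j => PosHom.proj (Fin.natAdd n j)) fun j => (hu j).symm]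
  refine hX.eval_mono _ fun t => PosHom.lpNorm_mono fun j => ?_
  simp only [PosHom.inf_apply, PosHom.abs_apply, PosHom.proj_apply]
  rw [abs_of_nonneg (le_inf (abs_nonneg _) (abs_nonneg _))]
  exact inf_le_right

variable {hX}

theorem PDominated.smul {y : X} {b : ℝ} (h : hX.PDominated p y b) (c : ℝ) :
    hX.PDominated p (c • y) (|c| * b) := by
  obtain ⟨m, x, hx, hy⟩ := h
  refine ⟨m, fun k => c • x k, ?_, ?_⟩
  · simp only [norm_smul]
    rw [PosHom.lpNorm_smul, Real.norm_eq_abs, abs_abs]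
    gcongr
  · rw [hX.eval_eq_subst x (fun k => c • PosHom.proj k) fun k => by rw [map_smul, eval_proj],
      show PosHom.subst (fun k => c • PosHom.proj k) (PosHom.lpNorm p m) =
        |c| • PosHom.lpNorm p m from PosHom.ext fun t => PosHom.lpNorm_smul c t, map_smul]
    exact (abs_smul_le_smul_abs c y).trans (smul_le_smul_of_nonneg_left hy (abs_nonneg c))

/-- Concatenation of tuples: a `p`-sum of dominated elements is dominated. -/
theorem PDominated.lpNorm {y : Fin n → X} {b : Fin n → ℝ} (h : ∀ j, hX.PDominated p (y j) (b j)) :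
    hX.PDominated p (hX.eval y (PosHom.lpNorm p n)) (PosHom.lpNorm p n b) := by
  choose m x hx hy using h
  set z : Fin (∑ j, m j) → X := fun s =>
    x (finSigmaFinEquiv.symm s).1 (finSigmaFinEquiv.symm s).2 with hz
  have hz' : ∀ j i, z (finSigmaFinEquiv ⟨j, i⟩) = x j i := fun j i => by
    simp only [hz]
    rw [Equiv.symm_apply_apply]
  refine ⟨_, z, ?_, ?_⟩
  · rw [PosHom.lpNorm_sigma]
    simp only [hz']
    exact PosHom.lpNorm_mono fun j => by
      rw [abs_of_nonneg (PosHom.lpNorm_nonneg _)]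
      exact (hx j).trans (le_abs_self _)
  · rw [abs_of_nonneg (hX.eval_lpNorm_nonneg y)]
    refine (hX.eval_lpNorm_mono (u := fun j => hX.eval (x j) (PosHom.lpNorm p (m j)))
      fun j => (hy j).trans (le_abs_self _)).trans (le_of_eq ?_)
    rw [hX.eval_eq_subst z
      (fun j => PosHom.subst (fun i => PosHom.proj (finSigmaFinEquiv ⟨j, i⟩))
        (PosHom.lpNorm p (m j)))
      fun j => hX.eval_eq_subst z _ (fun i => by rw [eval_proj, hz']) _]
    congr 1
    ext t
    exact (PosHom.lpNorm_sigma t).symm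

theorem PDominated.convexComb {x y : X} {a b : ℝ} (hx : hX.PDominated p x 1)
    (hy : hX.PDominated p y 1) (ha : 0 ≤ a) (hb : 0 ≤ b) (hab : a + b = 1) :
    hX.PDominated p (a • x + b • y) 1 := by
  set v : Fin 2 → X := ![a ^ (1 / p.toReal) • x, b ^ (1 / p.toReal) • y] with hv
  have h : hX.PDominated p (hX.eval v (PosHom.lpNorm p 2)) 1 := by
    refine (PDominated.lpNorm (b := ![a ^ (1 / p.toReal), b ^ (1 / p.toReal)]) ?_).mono le_rfl
      (PosHom.lpNorm_weights ha hb hab)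
    rw [Fin.forall_fin_two]
    have h1 := hx.smul (a ^ (1 / p.toReal))
    have h2 := hy.smul (b ^ (1 / p.toReal))
    rw [mul_one, abs_of_nonneg (by positivity)] at h1 h2
    exact ⟨h1, h2⟩
  refine h.mono ?_ le_rfl
  rw [abs_of_nonneg (hX.eval_lpNorm_nonneg v)]
  have e : hX.eval v (PosHom.lpNorm p 2) = hX.eval ![x, y] (PosHom.subst
      ![a ^ (1 / p.toReal) • PosHom.proj 0, b ^ (1 / p.toReal) • PosHom.proj 1]
      (PosHom.lpNorm p 2)) := by
    refine hX.eval_eq_subst _ _ ?_ _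
    rw [Fin.forall_fin_two]
    simp [hv, eval_proj]
  have e' : |a • x + b • y| =
      hX.eval ![x, y] |a • PosHom.proj 0 + b • PosHom.proj 1| := by
    rw [eval_abs]
    simp [eval_proj]
  rw [e, e']
  refine hX.eval_mono _ fun t => ?_
  have hc := PosHom.convexComb_le_lpNorm (p := p) ha hb hab (t 0) (t 1)
  have h3 : |a * t 0 + b * t 1| ≤ a * |t 0| + b * |t 1| := by
    refine (abs_add_le _ _).trans ?_
    rw [abs_mul, abs_mul, abs_of_nonneg ha, abs_of_nonneg hb]
  refine (h3.trans hc).trans (le_of_eq ?_)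
  rw [PosHom.subst_apply]
  congr 1
  ext j
  fin_cases j <;> rfl

end HasFunctionCalculus

/-! ### Renorming a `p`-convex Banach lattice -/

theorem PConvexWith.hasFunctionCalculus {p : ℝ≥0∞} [Fact (1 ≤ p)] {X : Type*}
    [NormedAddCommGroup X] [NormedSpace ℝ X] [Lattice X] {M : ℝ} (h : PConvexWith p X M) :
    HasFunctionCalculus X :=
  fun m x => (h m x).imp fun _ hΦ => hΦ.1

namespace HasFunctionCalculus

variable {X : Type*} [NormedAddCommGroup X] [NormedSpace ℝ X] [Lattice X]
  (hX : HasFunctionCalculus X) (p : ℝ≥0∞) [hp : Fact (1 ≤ p)]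

/-- The set of all elements dominated by a `p`-sum of weight at most `1`. -/
def pBall : Set X := {y | hX.PDominated p y 1}

/-- The gauge of `pBall`: the infimum of `(∑ₖ ‖xₖ‖ᵖ)^(1/p)` over all `x₁, …, xₘ` with
`|y| ≤ (∑ₖ |xₖ|ᵖ)^(1/p)`. If `X` is `p`-convex, this is the largest lattice norm below
the given one whose `p`-convexity constant is `1`. -/
noncomputable def pNorm (y : X) : ℝ := gauge (hX.pBall p) y

theorem pNorm_nonneg (y : X) : 0 ≤ hX.pNorm p y := gauge_nonneg y

theorem absorbent_pBall : Absorbent ℝ (hX.pBall p) := by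
  refine absorbent_nhds_zero
    (Filter.mem_of_superset (Metric.ball_mem_nhds 0 one_pos) fun y hy => ?_)
  exact (pDominated_norm y).mono le_rfl (by simpa using (mem_ball_zero_iff.1 hy).le)

variable [IsBanachLattice X]

theorem convex_pBall : Convex ℝ (hX.pBall p) :=
  fun _ hx _ hy _ _ ha hb hab => PDominated.convexComb hx hy ha hb hab

theorem balanced_pBall : Balanced ℝ (hX.pBall p) := by
  rintro c hc _ ⟨y, hy, rfl⟩
  exact (PDominated.smul hy c).mono le_rfl (by simpa using hc)

variable {hX p} in
open scoped Pointwise in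
theorem mem_smul_pBall {y : X} {b : ℝ} (hb : 0 < b) :
    y ∈ b • hX.pBall p ↔ hX.PDominated p y b := by
  rw [Set.mem_smul_set_iff_inv_smul_mem₀ hb.ne']
  constructor <;> intro h
  · have := PDominated.smul h b
    rwa [smul_inv_smul₀ hb.ne', abs_of_pos hb, mul_one] at this
  · have := h.smul b⁻¹
    rwa [abs_of_pos (inv_pos.2 hb), inv_mul_cancel₀ hb.ne'] at this

variable {hX p} in
theorem PDominated.pNorm_le {y : X} {b : ℝ} (h : hX.PDominated p y b) : hX.pNorm p y ≤ b :=
  le_of_forall_pos_le_add fun ε hε => by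
    have hb : 0 < b + ε := by linarith [h.nonneg]
    exact gauge_le_of_mem hb.le ((mem_smul_pBall hb).2 (h.mono le_rfl (by linarith)))

variable {hX p} in
theorem pDominated_of_pNorm_lt {y : X} {b : ℝ} (h : hX.pNorm p y < b) : hX.PDominated p y b := by
  obtain ⟨c, hc, hcb, hy⟩ := exists_lt_of_gauge_lt (hX.absorbent_pBall p) h
  exact ((mem_smul_pBall hc).1 hy).mono le_rfl hcb.le

theorem pNorm_add_le (x y : X) : hX.pNorm p (x + y) ≤ hX.pNorm p x + hX.pNorm p y :=
  gauge_add_le (hX.convex_pBall p) (hX.absorbent_pBall p) x y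

theorem pNorm_smul (c : ℝ) (x : X) : hX.pNorm p (c • x) = ‖c‖ * hX.pNorm p x :=
  gauge_smul (hX.balanced_pBall p) c x

theorem pNorm_le_norm (y : X) : hX.pNorm p y ≤ ‖y‖ := (pDominated_norm y).pNorm_le

theorem pNorm_solid {x y : X} (h : |x| ≤ |y|) : hX.pNorm p x ≤ hX.pNorm p y :=
  le_of_forall_pos_le_add fun _ hε =>
    ((pDominated_of_pNorm_lt (lt_add_of_pos_right _ hε)).mono h le_rfl).pNorm_le

theorem pNorm_eval_lpNorm_le {m : ℕ} (x : Fin m → X) :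
    hX.pNorm p (hX.eval x (PosHom.lpNorm p m)) ≤ PosHom.lpNorm p m fun k => hX.pNorm p (x k) := by
  have hcont : Continuous fun ε : ℝ => PosHom.lpNorm p m fun k => hX.pNorm p (x k) + ε :=
    (PosHom.lpNorm p m).1.continuous.comp (by fun_prop)
  have hlim := (hcont.tendsto 0).mono_left (nhdsWithin_le_nhds (s := Set.Ioi 0))
  simp only [add_zero] at hlim
  refine ge_of_tendsto hlim (Filter.eventually_of_mem self_mem_nhdsWithin fun ε hε => ?_)
  exact (PDominated.lpNorm fun k =>
    pDominated_of_pNorm_lt (lt_add_of_pos_right _ (Set.mem_Ioi.1 hε))).pNorm_le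

end HasFunctionCalculus

theorem PConvexWith.norm_le_mul_pNorm {p : ℝ≥0∞} [Fact (1 ≤ p)] {X : Type*}
    [NormedAddCommGroup X] [NormedSpace ℝ X] [Lattice X] [IsBanachLattice X] {M : ℝ} (hM : 1 ≤ M)
    (h : PConvexWith p X M) (y : X) : ‖y‖ ≤ M * h.hasFunctionCalculus.pNorm p y := by
  have h0 : 0 < M := by linarith
  refine le_of_forall_pos_le_add fun ε hε => ?_
  obtain ⟨m, x, hx, hy⟩ := HasFunctionCalculus.pDominated_of_pNorm_lt (hX := h.hasFunctionCalculus)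
    (p := p) (y := y) (lt_add_of_pos_right _ (div_pos hε h0))
  obtain ⟨Φ, hΦ, hle⟩ := h m x
  rw [(h.hasFunctionCalculus.isFunctionCalculus x).unique hΦ] at hy
  calc ‖y‖ ≤ ‖Φ (PosHom.lpNorm p m)‖ := norm_le_norm_of_abs_le_abs (hy.trans (le_abs_self _))
    _ ≤ M * (h.hasFunctionCalculus.pNorm p y + ε / M) :=
      hle.trans (mul_le_mul_of_nonneg_left hx h0.le)
    _ = _ := by field_simp

/-- A copy of the vector lattice `X`, to carry a second norm. -/
def Renorm (X : Type*) : Type _ := X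

namespace Renorm

variable (X : Type*) [NormedAddCommGroup X] [NormedSpace ℝ X] [Lattice X]

instance : AddCommGroup (Renorm X) := inferInstanceAs (AddCommGroup X)
instance : Module ℝ (Renorm X) := inferInstanceAs (Module ℝ X)
instance : Lattice (Renorm X) := inferInstanceAs (Lattice X)

/-- The identity map from `X` to its copy. -/
def toRenorm : X ≃ₗ[ℝ] Renorm X := LinearEquiv.refl ℝ X

theorem isLatticeHom_toRenorm : IsLatticeHom (toRenorm X : X →ₗ[ℝ] Renorm X) where
  map_sup _ _ := rfl
  map_inf _ _ := rfl

theorem isLatticeHom_toRenorm_symm :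
    IsLatticeHom ((toRenorm X).symm : Renorm X →ₗ[ℝ] X) where
  map_sup _ _ := rfl
  map_inf _ _ := rfl

end Renorm

/-- A `p`-convex Banach lattice has an equivalent lattice norm with `p`-convexity constant `1`. -/
theorem PConvexWith.exists_renorming {p : ℝ≥0∞} [Fact (1 ≤ p)] {X : Type w}
    [NormedAddCommGroup X] [NormedSpace ℝ X] [Lattice X] [IsBanachLattice X] {M : ℝ} (hM : 1 ≤ M)
    (h : PConvexWith p X M) :
    ∃ (Y : Type w) (_ : NormedAddCommGroup Y) (_ : NormedSpace ℝ Y) (_ : Lattice Y),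
      IsBanachLattice Y ∧ PConvexWith p Y 1 ∧
      ∃ e : X ≃ₗ[ℝ] Y, IsLatticeHom (e.symm : Y →ₗ[ℝ] X) ∧
        (∀ x, ‖e x‖ ≤ ‖x‖) ∧ ∀ x, ‖x‖ ≤ M * ‖e x‖ := by
  have hX := h.hasFunctionCalculus
  let : Norm (Renorm X) := ⟨fun x => hX.pNorm p ((Renorm.toRenorm X).symm x)⟩
  have core : NormedSpace.Core ℝ (Renorm X) :=
    { norm_nonneg := fun x => hX.pNorm_nonneg p _
      norm_smul := fun c x => hX.pNorm_smul p c _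
      norm_triangle := fun x y => hX.pNorm_add_le p _ _
      norm_eq_zero_iff := fun x => by
        refine ⟨fun h0 => ?_, fun h0 => ?_⟩
        · have := h.norm_le_mul_pNorm hM ((Renorm.toRenorm X).symm x)
          rw [show h.hasFunctionCalculus.pNorm p ((Renorm.toRenorm X).symm x) = 0 from h0,
            mul_zero, norm_le_zero_iff] at this
          simpa using this
        · subst h0
          exact le_antisymm ((hX.pNorm_le_norm p _).trans_eq (by simp)) (hX.pNorm_nonneg p _) }
  let : NormedAddCommGroup (Renorm X) := .ofCore core
  let : NormedSpace ℝ (Renorm X) := .ofCore core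
  have hle : ∀ x, ‖Renorm.toRenorm X x‖ ≤ ‖x‖ := fun x => hX.pNorm_le_norm p x
  have hge : ∀ x, ‖x‖ ≤ M * ‖Renorm.toRenorm X x‖ := fun x => h.norm_le_mul_pNorm hM x
  refine ⟨Renorm X, inferInstance, inferInstance, inferInstance, ?_, ?_, Renorm.toRenorm X,
    Renorm.isLatticeHom_toRenorm_symm X, hle, hge⟩
  · have : IsOrderedAddMonoid (Renorm X) := inferInstanceAs (IsOrderedAddMonoid X)
    have : IsOrderedModule ℝ (Renorm X) := inferInstanceAs (IsOrderedModule ℝ X)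
    have : HasSolidNorm (Renorm X) := ⟨fun _ _ hxy => hX.pNorm_solid p hxy⟩
    have : CompleteSpace (Renorm X) := by
      let e : X ≃L[ℝ] Renorm X := (Renorm.toRenorm X).toContinuousLinearEquivOfBounds 1 M
        (fun x => by simpa using hle x) (fun x => by simpa using hge ((Renorm.toRenorm X).symm x))
      exact (completeSpace_congr (e := e.toEquiv) e.isUniformEmbedding).1 inferInstance
    exact {}
  · intro m x
    have hΦ := hX.isFunctionCalculus (fun k => (Renorm.toRenorm X).symm (x k))
    refine ⟨(Renorm.toRenorm X : X →ₗ[ℝ] Renorm X) ∘ₗ hX.eval _, hΦ.map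
      (Renorm.isLatticeHom_toRenorm X), ?_⟩
    rw [one_mul]
    exact hX.pNorm_eval_lpNorm_le p _

/-! ### Automatic continuity and isometric lattice isomorphisms -/

section

variable {X Y : Type*} [NormedAddCommGroup X] [NormedSpace ℝ X] [Lattice X]
  [NormedAddCommGroup Y] [NormedSpace ℝ Y] [Lattice Y]

/-- Lattice homomorphisms between Banach lattices are automatically bounded: otherwise there are
positive `yₙ` with `‖yₙ‖ ≤ 2⁻ⁿ` and `‖S yₙ‖ ≥ n`, and `∑ yₙ` cannot have an image. -/
theorem IsLatticeHom.exists_bound [IsBanachLattice X] [IsBanachLattice Y] {S : X →ₗ[ℝ] Y}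
    (hS : IsLatticeHom S) : ∃ C : ℝ, ∀ x, ‖S x‖ ≤ C * ‖x‖ := by
  by_contra! hcon
  choose x hx using fun n : ℕ => hcon (n * 2 ^ n)
  have hpos : ∀ n, 0 < ‖x n‖ := fun n => by
    rw [norm_pos_iff]
    intro h0
    have := hx n
    simp [h0] at this
  set y : ℕ → X := fun n => (2 ^ n * ‖x n‖)⁻¹ • |x n| with hy
  have hy0 : ∀ n, 0 ≤ y n := fun n =>
    smul_nonneg (inv_nonneg.2 (by have := hpos n; positivity)) (abs_nonneg _)
  have hynorm : ∀ n, ‖y n‖ = (1 / 2) ^ n := fun n => by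
    have := (hpos n).ne'
    simp only [hy]
    rw [norm_smul, norm_abs_eq_norm, norm_inv, norm_mul, norm_norm, norm_pow, Real.norm_ofNat,
      mul_inv, mul_assoc, inv_mul_cancel₀ this, mul_one, one_div, inv_pow]
  have hsum : Summable y := Summable.of_norm (by
    simp only [hynorm]
    exact summable_geometric_two)
  have hSy : ∀ n : ℕ, (n : ℝ) ≤ ‖S (∑' k, y k)‖ := fun n => by
    have h1 : y n ≤ ∑' k, y k := hsum.le_tsum n fun k _ => hy0 k
    have h2 : |S (y n)| ≤ |S (∑' k, y k)| := by
      have h3 : 0 ≤ S (y n) := by simpa using hS.monotone (hy0 n)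
      rw [abs_of_nonneg h3]
      exact (hS.monotone h1).trans (le_abs_self _)
    refine le_trans ?_ (norm_le_norm_of_abs_le_abs h2)
    have := hpos n
    simp only [hy]
    rw [map_smul, norm_smul, hS.map_abs, norm_abs_eq_norm, norm_inv, norm_mul, norm_norm, norm_pow,
      Real.norm_ofNat, inv_mul_eq_div, le_div_iff₀ (by positivity), ← mul_assoc]
    exact (hx n).le
  obtain ⟨n, hn⟩ := exists_nat_gt ‖S (∑' k, y k)‖
  exact (hSy n).not_gt hn

variable {U : X ≃ₗᵢ[ℝ] Y}

theorem IsLatticeHom.le_iff (hU : IsLatticeHom (U.toLinearEquiv : X →ₗ[ℝ] Y)) (x y : X) :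
    x ≤ y ↔ U x ≤ U y := by
  have : U (x ⊔ y) = U x ⊔ U y := hU.map_sup x y
  rw [← sup_eq_right, ← sup_eq_right, ← this, U.injective.eq_iff]

theorem IsLatticeHom.symm (hU : IsLatticeHom (U.toLinearEquiv : X →ₗ[ℝ] Y)) :
     IsLatticeHom (U.symm.toLinearEquiv : Y →ₗ[ℝ] X) where
  map_sup x y := U.injective <| by
    have : U (U.symm x ⊔ U.symm y) = U (U.symm x) ⊔ U (U.symm y) := hU.map_sup _ _
    change U (U.symm (x ⊔ y)) = U (U.symm x ⊔ U.symm y)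
    rw [this]
    simp only [LinearIsometryEquiv.apply_symm_apply]
  map_inf x y := U.injective <| by
    have : U (U.symm x ⊓ U.symm y) = U (U.symm x) ⊓ U (U.symm y) := hU.map_inf _ _
    change U (U.symm (x ⊓ y)) = U (U.symm x ⊓ U.symm y)
    rw [this]
    simp only [LinearIsometryEquiv.apply_symm_apply]

theorem IsBanachLattice.of_linearIsometryEquiv [IsBanachLattice Y]
    (hU : IsLatticeHom (U.toLinearEquiv : X →ₗ[ℝ] Y)) : IsBanachLattice X where
  add_le_add_left x y h z := by
    rw [hU.le_iff] at h ⊢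
    simpa only [map_add] using add_le_add_left h (U z)
  smul_le_smul_of_nonneg_left c hc x y h := by
    rw [hU.le_iff] at h ⊢
    simpa only [map_smul] using smul_le_smul_of_nonneg_left h hc
  smul_le_smul_of_nonneg_right x hx c d h := by
    rw [hU.le_iff] at hx ⊢
    simpa only [map_smul, map_zero] using smul_le_smul_of_nonneg_right h (by simpa using hx)
  solid x y h := by
    have : |U x| ≤ |U y| := by
      have hx : U |x| = |U x| := hU.map_abs x
      have hy : U |y| = |U y| := hU.map_abs y
      rw [← hx, ← hy, ← hU.le_iff]
      exact h
    simpa using norm_le_norm_of_abs_le_abs this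
  toCompleteSpace :=
    (completeSpace_congr (e := U.toEquiv) U.isometry.isUniformEmbedding).2 inferInstance

theorem PConvexWith.of_linearIsometryEquiv {p : ℝ≥0∞} [Fact (1 ≤ p)] {M : ℝ}
    (hU : IsLatticeHom (U.toLinearEquiv : X →ₗ[ℝ] Y))
    (h : PConvexWith p Y M) : PConvexWith p X M := by
  intro m x
  obtain ⟨Φ, hΦ, hle⟩ := h m fun k => U (x k)
  refine ⟨(U.symm.toLinearEquiv : Y →ₗ[ℝ] X) ∘ₗ Φ, ?_, ?_⟩
  · have := hΦ.map hU.symm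
    simpa using this
  · simpa using hle

end

/-! ### Closed sublattices generated by a map -/

/-- Formal expressions in the operations of a vector lattice, with variables from `E`. They live in
the universe of `E`, and so bound the size of the lattices generated by images of `E`. -/
inductive LatticeTerm (E : Type u) : Type u
  | var (x : E)
  | zero
  | add (s t : LatticeTerm E)
  | smul (c : ℝ) (t : LatticeTerm E)
  | sup (s t : LatticeTerm E)
  | inf (s t : LatticeTerm E)

namespace LatticeTerm

variable {E : Type u} {X Y : Type*} [AddCommGroup X] [Module ℝ X] [Lattice X]
  [AddCommGroup Y] [Module ℝ Y] [Lattice Y]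

/-- The value of a term when its variables are interpreted by `f`. -/
def eval (f : E → X) : LatticeTerm E → X
  | var x => f x
  | zero => 0
  | add s t => eval f s + eval f t
  | smul c t => c • eval f t
  | sup s t => eval f s ⊔ eval f t
  | inf s t => eval f s ⊓ eval f t

theorem _root_.IsLatticeHom.map_eval {S : X →ₗ[ℝ] Y} (hS : IsLatticeHom S) (f : E → X)
    (t : LatticeTerm E) : S (eval f t) = eval (fun x => S (f x)) t := by
  induction t with
  | var x => rfl
  | zero => simp [eval]
  | add s t hs ht => simp [eval, hs, ht]
  | smul c t ht => simp [eval, ht]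
  | sup s t hs ht => simp [eval, hS.map_sup, hs, ht]
  | inf s t hs ht => simp [eval, hS.map_inf, hs, ht]

end LatticeTerm

/-- Bounded lattice homomorphisms that agree on a set of generators are equal. -/
theorem IsLatticeHom.eq_of_denseRange {E : Type u} {X Y : Type*}
    [NormedAddCommGroup X] [NormedSpace ℝ X] [Lattice X] [IsBanachLattice X]
    [NormedAddCommGroup Y] [NormedSpace ℝ Y] [Lattice Y] [IsBanachLattice Y] {f : E → X}
    (hf : DenseRange (LatticeTerm.eval f)) {S T : X →ₗ[ℝ] Y} (hS : IsLatticeHom S)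
    (hT : IsLatticeHom T) (h : ∀ x, S (f x) = T (f x)) : S = T := by
  obtain ⟨C, hC⟩ := hS.exists_bound
  obtain ⟨D, hD⟩ := hT.exists_bound
  have : (S : X → Y) = T := hf.equalizer (S.mkContinuous C hC).continuous
    (T.mkContinuous D hD).continuous <| funext fun t => by
      change S _ = T _
      rw [hS.map_eval, hT.map_eval]
      simp only [h]
  exact LinearMap.ext fun x => congrFun this x

section latticeSpan

open LatticeTerm

variable {E : Type u} {X : Type*} [NormedAddCommGroup X] [NormedSpace ℝ X] [Lattice X]
  (f : E → X)

/-- The closed vector sublattice generated by the values of `f`. -/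
def latticeSpan : Submodule ℝ X where
  carrier := closure (Set.range (LatticeTerm.eval f))
  zero_mem' := subset_closure ⟨.zero, rfl⟩
  add_mem' ha hb := map_mem_closure₂ continuous_add ha hb <| by
    rintro _ ⟨s, rfl⟩ _ ⟨t, rfl⟩
    exact ⟨s.add t, rfl⟩
  smul_mem' c _ ha := map_mem_closure (continuous_const_smul c) ha <| by
    rintro _ ⟨t, rfl⟩
    exact ⟨t.smul c, rfl⟩

instance small_latticeSpan : Small.{u} (latticeSpan f) := by
  -- A point of the closure is the limit of a sequence of terms.
  classical
  let lim : (ℕ → LatticeTerm E) → X := fun s =>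
    if h : ∃ a, Filter.Tendsto (fun n => LatticeTerm.eval f (s n)) Filter.atTop (nhds a)
    then h.choose else 0
  have hsub : (latticeSpan f : Set X) ⊆ Set.range lim := by
    intro a ha
    obtain ⟨v, hv, hlim⟩ := mem_closure_iff_seq_limit.1 ha
    choose s hs using hv
    have h : ∃ a, Filter.Tendsto (fun n => LatticeTerm.eval f (s n)) Filter.atTop (nhds a) :=
      ⟨a, by simpa only [hs] using hlim⟩
    refine ⟨s, ?_⟩
    simp only [lim, dif_pos h]
    exact tendsto_nhds_unique h.choose_spec (by simpa only [hs] using hlim)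
  exact small_subset hsub

/-- `f` as a map into the closed sublattice that it generates. -/
def toLatticeSpan (x : E) : latticeSpan f := ⟨f x, subset_closure ⟨.var x, rfl⟩⟩

variable [IsBanachLattice X]

theorem sup_mem_latticeSpan {a b : X} (ha : a ∈ latticeSpan f) (hb : b ∈ latticeSpan f) :
    a ⊔ b ∈ latticeSpan f :=
  map_mem_closure₂ continuous_sup ha hb <| by
    rintro _ ⟨s, rfl⟩ _ ⟨t, rfl⟩
    exact ⟨s.sup t, rfl⟩

theorem inf_mem_latticeSpan {a b : X} (ha : a ∈ latticeSpan f) (hb : b ∈ latticeSpan f) :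
    a ⊓ b ∈ latticeSpan f :=
  map_mem_closure₂ continuous_inf ha hb <| by
    rintro _ ⟨s, rfl⟩ _ ⟨t, rfl⟩
    exact ⟨s.inf t, rfl⟩

instance : Lattice (latticeSpan f) :=
  Subtype.lattice (fun _ _ ha hb => sup_mem_latticeSpan f ha hb)
    (fun _ _ ha hb => inf_mem_latticeSpan f ha hb)

theorem isLatticeHom_subtype_latticeSpan : IsLatticeHom (latticeSpan f).subtype where
  map_sup _ _ := rfl
  map_inf _ _ := rfl

instance : IsBanachLattice (latticeSpan f) where
  add_le_add_left _ _ h c := add_le_add_left (α := X) h c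
  smul_le_smul_of_nonneg_left _ hc _ _ h := smul_le_smul_of_nonneg_left (β := X) h hc
  smul_le_smul_of_nonneg_right _ hx _ _ h := smul_le_smul_of_nonneg_right (β := X) h hx
  solid _ _ h := norm_le_norm_of_abs_le_abs (α := X) h
  toCompleteSpace := (isClosed_closure (s := Set.range (LatticeTerm.eval f))).completeSpace_coe

theorem denseRange_eval_toLatticeSpan : DenseRange (LatticeTerm.eval (toLatticeSpan f)) := by
  have hcoe : ∀ t, ((LatticeTerm.eval (toLatticeSpan f) t : latticeSpan f) : X) =
      LatticeTerm.eval f t := fun t => (isLatticeHom_subtype_latticeSpan f).map_eval _ t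
  intro a
  rw [closure_subtype, ← Set.range_comp]
  have : (Subtype.val ∘ LatticeTerm.eval (toLatticeSpan f) : LatticeTerm E → X) =
    LatticeTerm.eval f := funext hcoe
  rw [this]
  exact a.2

theorem PConvexWith.latticeSpan {p : ℝ≥0∞} [Fact (1 ≤ p)] {M : ℝ} (h : PConvexWith p X M) :
    PConvexWith p (latticeSpan f) M := by
  intro m x
  obtain ⟨Φ, hΦ, hle⟩ := h m fun k => (x k : X)
  refine ⟨Φ.codRestrict _ fun g => hΦ.mem_of_isClosed _ isClosed_closure
    (fun _ ha _ hb => sup_mem_latticeSpan f ha hb) (fun _ ha _ hb => inf_mem_latticeSpan f ha hb)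
    (fun k => (x k).2) g, ⟨⟨fun a b => Subtype.ext (hΦ.isLatticeHom.map_sup a b),
      fun a b => Subtype.ext (hΦ.isLatticeHom.map_inf a b)⟩,
      fun k => Subtype.ext (hΦ.map_proj k)⟩, hle⟩

end latticeSpan

/-! ### Bounded products of Banach lattices -/

section

variable {ι : Type*} {X : ι → Type*} [∀ i, NormedAddCommGroup (X i)]
  [∀ i, NormedSpace ℝ (X i)] [∀ i, Lattice (X i)] [∀ i, IsBanachLattice (X i)]

/-- The `ℓ^∞`-product of Banach lattices is a vector lattice for the coordinatewise operations. -/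
instance lp.instLatticeInfty : Lattice (lp X ∞) where
  le f g := ∀ i, f i ≤ g i
  le_refl f i := le_rfl
  le_trans f g h hfg hgh i := (hfg i).trans (hgh i)
  le_antisymm f g hfg hgf := lp.ext (funext fun i => (hfg i).antisymm (hgf i))
  sup f g := ⟨fun i => f i ⊔ g i, memℓp_infty ⟨‖f‖ + ‖g‖, by
    rintro _ ⟨i, rfl⟩
    exact (norm_sup_le_add _ _).trans (add_le_add (lp.norm_apply_le_norm ENNReal.top_ne_zero f i)
      (lp.norm_apply_le_norm ENNReal.top_ne_zero g i))⟩⟩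
  le_sup_left _ _ _ := le_sup_left
  le_sup_right _ _ _ := le_sup_right
  sup_le _ _ _ hfh hgh i := sup_le (hfh i) (hgh i)
  inf f g := ⟨fun i => f i ⊓ g i, memℓp_infty ⟨‖f‖ + ‖g‖, by
    rintro _ ⟨i, rfl⟩
    exact (norm_inf_le_add _ _).trans (add_le_add (lp.norm_apply_le_norm ENNReal.top_ne_zero f i)
      (lp.norm_apply_le_norm ENNReal.top_ne_zero g i))⟩⟩
  inf_le_left _ _ _ := inf_le_left
  inf_le_right _ _ _ := inf_le_right
  le_inf _ _ _ hfg hfh i := le_inf (hfg i) (hfh i)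

/-- The coordinate projections of the `ℓ^∞`-product. -/
def lp.coordInfty (i : ι) : lp X ∞ →ₗ[ℝ] X i where
  toFun f := f i
  map_add' _ _ := rfl
  map_smul' _ _ := rfl

theorem lp.isLatticeHom_coordInfty (i : ι) : IsLatticeHom (lp.coordInfty (X := X) i) where
  map_sup _ _ := rfl
  map_inf _ _ := rfl

instance lp.isBanachLattice_infty : IsBanachLattice (lp X ∞) where
  add_le_add_left _ _ h c i := add_le_add_left (h i) (c i)
  smul_le_smul_of_nonneg_left _ hc _ _ h i := smul_le_smul_of_nonneg_left (h i) hc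
  smul_le_smul_of_nonneg_right _ hx _ _ h i := smul_le_smul_of_nonneg_right h (hx i)
  solid _ g h := lp.norm_le_of_forall_le (norm_nonneg g) fun i =>
    (norm_le_norm_of_abs_le_abs (h i)).trans (lp.norm_apply_le_norm ENNReal.top_ne_zero g i)

theorem PConvexWith.lp_infty {p : ℝ≥0∞} [Fact (1 ≤ p)] {M : ℝ} (hM : 0 ≤ M)
    (h : ∀ i, PConvexWith p (X i) M) : PConvexWith p (lp X ∞) M := by
  intro m x
  choose Φ hΦ hle using fun i => h i m fun k => x k i
  have hmem : ∀ g : PosHom m, Memℓp (fun i => Φ i g) ∞ := fun g => by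
    obtain ⟨C, hC, hg⟩ := PosHom.exists_abs_le g
    refine memℓp_infty ⟨C * ∑ k, ‖x k‖, ?_⟩
    rintro _ ⟨i, rfl⟩
    refine ((hΦ i).norm_le hC hg).trans ?_
    gcongr with k
    exact lp.norm_apply_le_norm ENNReal.top_ne_zero (x k) i
  refine ⟨{ toFun := fun g => ⟨fun i => Φ i g, hmem g⟩
            map_add' := fun f g => lp.ext (funext fun i => map_add (Φ i) f g)
            map_smul' := fun c g => lp.ext (funext fun i => map_smul (Φ i) c g) },
    ⟨⟨fun f g => lp.ext (funext fun i => (hΦ i).isLatticeHom.map_sup f g),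
      fun f g => lp.ext (funext fun i => (hΦ i).isLatticeHom.map_inf f g)⟩,
      fun k => lp.ext (funext fun i => (hΦ i).map_proj k)⟩, ?_⟩
  refine lp.norm_le_of_forall_le (mul_nonneg hM (norm_nonneg _)) fun i => (hle i).trans ?_
  gcongr
  exact PosHom.lpNorm_mono fun k => by
    simpa using lp.norm_apply_le_norm ENNReal.top_ne_zero (x k) i

end

theorem pConvexWith_real (p : ℝ≥0∞) [Fact (1 ≤ p)] : PConvexWith p ℝ 1 := by
  intro m x
  refine ⟨{ toFun := fun g => g x, map_add' := fun _ _ => rfl, map_smul' := fun _ _ => rfl },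
    ⟨⟨fun _ _ => rfl, fun _ _ => rfl⟩, fun _ => rfl⟩, ?_⟩
  rw [one_mul]
  exact (abs_of_nonneg (PosHom.lpNorm_nonneg x)).trans_le
    (PosHom.lpNorm_mono fun k => by simp)

instance : IsBanachLattice ℝ where

/-! ### The free `p`-convex Banach lattice -/

/-- The contractions from `E` into Banach lattices, in the universe of `E`, with `p`-convexity
constant `1`. -/
structure PConvexContraction (p : ℝ≥0∞) [Fact (1 ≤ p)] (E : Type u) [NormedAddCommGroup E]
    [NormedSpace ℝ E] : Type (u + 1) where
  X : Type u
  [normedAddCommGroup : NormedAddCommGroup X]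
  [normedSpace : NormedSpace ℝ X]
  [lattice : Lattice X]
  [isBanachLattice : IsBanachLattice X]
  pConvexWith : PConvexWith p X 1
  T : E →ₗ[ℝ] X
  norm_le : ∀ x, ‖T x‖ ≤ ‖x‖

namespace PConvexContraction

attribute [instance] normedAddCommGroup normedSpace lattice isBanachLattice

variable (p : ℝ≥0∞) [hp : Fact (1 ≤ p)] (E : Type u) [NormedAddCommGroup E] [NormedSpace ℝ E]

/-- The `ℓ^∞`-product of the targets of all contractions. -/
abbrev Target : Type (u + 1) := lp (fun i : PConvexContraction p E => i.X) ∞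

variable {E} in
theorem memℓp_apply (x : E) : Memℓp (fun i : PConvexContraction p E => i.T x) ∞ :=
  memℓp_infty ⟨‖x‖, by
    rintro _ ⟨i, rfl⟩
    exact i.norm_le x⟩

/-- The simultaneous contraction `x ↦ (T x)_T` into the product. -/
def diag : E →ₗ[ℝ] Target p E where
  toFun x := ⟨fun i => i.T x, memℓp_apply p x⟩
  map_add' x y := lp.ext (funext fun i => map_add i.T x y)
  map_smul' c x := lp.ext (funext fun i => map_smul i.T c x)

variable {E} in
theorem norm_diag_le (x : E) : ‖diag p E x‖ ≤ ‖x‖ :=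
  lp.norm_le_of_forall_le (norm_nonneg x) fun i => i.norm_le x

end PConvexContraction

section Shrink

variable (α : Type w) [NormedAddCommGroup α] [NormedSpace ℝ α] [Lattice α] [Small.{v} α]

noncomputable instance : Lattice (Shrink.{v} α) := (equivShrink α).symm.lattice

/-- A small normed lattice is isometric to its copy in a smaller universe. -/
noncomputable def shrinkIsometry : Shrink.{v} α ≃ₗᵢ[ℝ] α where
  toLinearEquiv := Shrink.linearEquiv ℝ α
  norm_map' _ := rfl

theorem isLatticeHom_shrinkIsometry :
    IsLatticeHom ((shrinkIsometry.{v} α).toLinearEquiv : Shrink.{v} α →ₗ[ℝ] α) where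
  map_sup _ _ := (equivShrink α).symm_apply_apply _
  map_inf _ _ := (equivShrink α).symm_apply_apply _

end Shrink

section FreePConvex

open PConvexContraction

variable (p : ℝ≥0∞) [hp : Fact (1 ≤ p)] (E : Type u) [NormedAddCommGroup E] [NormedSpace ℝ E]

/-- The free `p`-convex Banach lattice over `E`: the closed sublattice generated by the image of `E`
in the product of all targets, moved to the universe of `E`. -/
abbrev FreePConvex : Type u := Shrink.{u} (latticeSpan (diag p E))

instance : IsBanachLattice (FreePConvex p E) :=
  .of_linearIsometryEquiv (isLatticeHom_shrinkIsometry _)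

namespace FreePConvex

theorem pConvexWith : PConvexWith p (FreePConvex p E) 1 :=
  .of_linearIsometryEquiv (isLatticeHom_shrinkIsometry _)
    (PConvexWith.latticeSpan _ (.lp_infty zero_le_one fun i => i.pConvexWith))

/-- The canonical map of `E` into the free `p`-convex Banach lattice. -/
noncomputable def of : E →ₗ[ℝ] FreePConvex p E :=
  ((shrinkIsometry.{u} (latticeSpan (diag p E))).symm.toLinearEquiv :
    latticeSpan (diag p E) →ₗ[ℝ] FreePConvex p E) ∘ₗ
    (diag p E).codRestrict _ fun x => (toLatticeSpan (diag p E) x).2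

variable {E}

theorem norm_of_le (x : E) : ‖of p E x‖ ≤ ‖x‖ :=
  ((shrinkIsometry (latticeSpan (diag p E))).symm.norm_map _).trans_le (norm_diag_le p x)

theorem denseRange_eval_of : DenseRange (LatticeTerm.eval (of p E)) := by
  have h := (shrinkIsometry.{u} (latticeSpan (diag p E))).symm.surjective.denseRange.comp
    (denseRange_eval_toLatticeSpan (diag p E)) (LinearIsometryEquiv.continuous _)
  convert h using 1
  funext t
  exact ((isLatticeHom_shrinkIsometry _).symm.map_eval (toLatticeSpan (diag p E)) t).symm

/-- A contraction `T` into a lattice of arbitrary size factors through the closed sublattice that it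
generates, which is the target of one of the coordinates of `diag p E`. -/
theorem exists_lift_of_contraction {X : Type w} [NormedAddCommGroup X] [NormedSpace ℝ X] [Lattice X]
    [IsBanachLattice X] (hX : PConvexWith p X 1) (T : E →ₗ[ℝ] X) (hT : ∀ x, ‖T x‖ ≤ ‖x‖) :
    ∃ S : FreePConvex p E →ₗ[ℝ] X, IsLatticeHom S ∧ (∀ x, S (of p E x) = T x) ∧
      ∀ f, ‖S f‖ ≤ ‖f‖ := by
  let V := shrinkIsometry.{u} (latticeSpan T)
  have hV := isLatticeHom_shrinkIsometry.{u} (latticeSpan T)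
  have : IsBanachLattice (Shrink.{u} (latticeSpan T)) := .of_linearIsometryEquiv hV
  let i : PConvexContraction p E :=
    { X := Shrink.{u} (latticeSpan T)
      pConvexWith := .of_linearIsometryEquiv hV (hX.latticeSpan T)
      T := (V.symm.toLinearEquiv : latticeSpan T →ₗ[ℝ] _) ∘ₗ
        T.codRestrict _ fun x => (toLatticeSpan T x).2
      norm_le := fun x => (V.symm.norm_map _).trans_le (hT x) }
  let W := shrinkIsometry.{u} (latticeSpan (diag p E))
  let S : FreePConvex p E →ₗ[ℝ] X := (latticeSpan T).subtype ∘ₗ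
    (V.toLinearEquiv : Shrink.{u} (latticeSpan T) →ₗ[ℝ] latticeSpan T) ∘ₗ lp.coordInfty i ∘ₗ
    (latticeSpan (diag p E)).subtype ∘ₗ (W.toLinearEquiv : FreePConvex p E →ₗ[ℝ] _)
  refine ⟨S, ?_, fun x => ?_, fun f => ?_⟩
  · exact (isLatticeHom_subtype_latticeSpan T).comp <| hV.comp <|
      (lp.isLatticeHom_coordInfty i).comp <| (isLatticeHom_subtype_latticeSpan _).comp
        (isLatticeHom_shrinkIsometry _)
  · have h1 : W (of p E x) = ⟨diag p E x, (toLatticeSpan (diag p E) x).2⟩ :=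
      W.apply_symm_apply _
    change ((V ((W (of p E x) : Target p E) i) : latticeSpan T) : X) = T x
    rw [h1]
    exact congrArg Subtype.val (V.apply_symm_apply _)
  · calc ‖S f‖ = ‖V ((W f : Target p E) i)‖ := rfl
      _ = ‖(W f : Target p E) i‖ := V.norm_map _
      _ ≤ ‖(W f : Target p E)‖ := lp.norm_apply_le_norm ENNReal.top_ne_zero _ i
      _ = ‖f‖ := W.norm_map f

theorem norm_of (x : E) : ‖of p E x‖ = ‖x‖ := by
  refine (norm_of_le p x).antisymm ?_
  rcases eq_or_ne x 0 with rfl | hx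
  · simp
  obtain ⟨g, hg, hgx⟩ := exists_dual_vector ℝ x (norm_ne_zero_iff.2 hx)
  obtain ⟨S, -, hS, hle⟩ := exists_lift_of_contraction p (pConvexWith_real p) (g : E →ₗ[ℝ] ℝ)
    fun y => (g.le_opNorm y).trans (by rw [hg, one_mul])
  calc ‖x‖ = ‖S (of p E x)‖ := by
        rw [hS]
        change ‖x‖ = ‖g x‖
        rw [hgx]
        simp
    _ ≤ ‖of p E x‖ := hle _

/-- The canonical isometry of `E` into the free `p`-convex Banach lattice. -/
noncomputable def ofₗᵢ : E →ₗᵢ[ℝ] FreePConvex p E := ⟨of p E, norm_of p⟩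

/-- The universal property with the norm bound for any constant `M` of `p`-convexity: renorm the
target, rescale to a contraction, and lift that. -/
theorem exists_lift {X : Type w} [NormedAddCommGroup X] [NormedSpace ℝ X] [Lattice X]
    [IsBanachLattice X] {M : ℝ} (hM : 1 ≤ M) (hX : PConvexWith p X M) (T : E →L[ℝ] X) :
    ∃ S : FreePConvex p E →ₗ[ℝ] X, IsLatticeHom S ∧ (∀ x, S (of p E x) = T x) ∧
      ∀ f, ‖S f‖ ≤ M * ‖T‖ * ‖f‖ := by
  rcases eq_or_ne T 0 with rfl | hT
  · exact ⟨0, ⟨fun _ _ => by simp, fun _ _ => by simp⟩, fun _ => rfl, fun f => by simp⟩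
  have hpos : 0 < ‖T‖ := norm_pos_iff.2 hT
  obtain ⟨Y, _, _, _, _, hconv, e, he, hle, hge⟩ := hX.exists_renorming hM
  obtain ⟨S, hS, hSφ, hSle⟩ := exists_lift_of_contraction p hconv
    (‖T‖⁻¹ • (e : X →ₗ[ℝ] Y) ∘ₗ (T : E →ₗ[ℝ] X)) fun x => by
      change ‖‖T‖⁻¹ • e (T x)‖ ≤ ‖x‖
      rw [norm_smul, norm_inv, norm_norm, inv_mul_le_iff₀ hpos]
      exact (hle _).trans (T.le_opNorm x)
  have hR := he.comp hS
  refine ⟨‖T‖ • (e.symm : Y →ₗ[ℝ] X) ∘ₗ S, ⟨fun f g => ?_, fun f g => ?_⟩, fun x => ?_,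
    fun f => ?_⟩
  · simp only [LinearMap.smul_apply, hR.map_sup]
    exact map_sup (OrderIso.smulRight hpos) _ _
  · simp only [LinearMap.smul_apply, hR.map_inf]
    exact map_inf (OrderIso.smulRight hpos) _ _
  · change ‖T‖ • e.symm (S (of p E x)) = T x
    rw [hSφ]
    change ‖T‖ • e.symm (‖T‖⁻¹ • e (T x)) = T x
    rw [map_smul, e.symm_apply_apply, smul_inv_smul₀ hpos.ne']
  · change ‖‖T‖ • e.symm (S f)‖ ≤ _
    have h1 := hge (e.symm (S f))
    rw [e.apply_symm_apply] at h1
    rw [norm_smul, norm_norm, mul_comm M, mul_assoc]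
    gcongr
    exact h1.trans (mul_le_mul_of_nonneg_left (hSle f) (by linarith))

theorem isFreePConvex : IsFreePConvex.{v} p (ofₗᵢ p (E := E)) where
  isBanachLattice := inferInstance
  isPConvex := ⟨1, le_rfl, pConvexWith p E⟩
  pConvexityConst_eq_one := IsLeast.csInf_eq ⟨⟨le_rfl, pConvexWith p E⟩, fun _ h => h.1⟩
  exists_unique_extension X _ _ _ _ hX T := by
    have hlift := fun M (hM : 1 ≤ M ∧ PConvexWith p X M) => exists_lift p hM.1 hM.2 T
    have huniq : ∀ S S' : FreePConvex p E →ₗ[ℝ] X, IsLatticeHom S → IsLatticeHom S' →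
        (∀ x, S (of p E x) = T x) → (∀ x, S' (of p E x) = T x) → S = S' :=
      fun S S' hS hS' h h' => hS.eq_of_denseRange (denseRange_eval_of p) hS' fun x => by
        rw [h, h']
    obtain ⟨M, hM⟩ := hX
    obtain ⟨S, hS, hSφ, hSle⟩ := hlift M hM
    refine ⟨S.mkContinuous _ hSle, hS, hSφ, ?_, fun S' hS' h => huniq _ _ hS' hS h hSφ⟩
    -- By uniqueness the bound holds for every admissible constant, hence for their infimum.
    have hall : ∀ N, 1 ≤ N ∧ PConvexWith p X N → ‖S.mkContinuous _ hSle‖ ≤ N * ‖T‖ := by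
      intro N hN
      obtain ⟨R, hR, hRφ, hRle⟩ := hlift N hN
      obtain rfl := huniq S R hS hR hSφ hRφ
      exact ContinuousLinearMap.opNorm_le_bound _
        (mul_nonneg (by linarith [hN.1]) (norm_nonneg T)) hRle
    rcases (norm_nonneg T).eq_or_lt with h0 | h0
    · exact (hall M hM).trans_eq (by rw [← h0, mul_zero, mul_zero])
    · rw [← div_le_iff₀ h0]
      exact le_csInf ⟨M, hM⟩ fun N hN => (div_le_iff₀ h0).2 (hall N hN)

end FreePConvex

end FreePConvex

/-! ### Uniqueness -/

/-- The norm bound of the universal property in the form used for spaces with constant `1`. -/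
theorem IsFreePConvex.exists_contraction {p : ℝ≥0∞} [Fact (1 ≤ p)] {E : Type u}
    [NormedAddCommGroup E] [NormedSpace ℝ E] {F : Type w} [NormedAddCommGroup F] [NormedSpace ℝ F]
    [Lattice F] {φ : E →ₗᵢ[ℝ] F} (h : IsFreePConvex.{v} p φ) {X : Type v} [NormedAddCommGroup X]
    [NormedSpace ℝ X] [Lattice X] [IsBanachLattice X] (hX : IsPConvex p X)
    (hX1 : pConvexityConst p X ≤ 1) (T : E →ₗᵢ[ℝ] X) :
    ∃ S : F →ₗ[ℝ] X, IsLatticeHom S ∧ (∀ x, S (φ x) = T x) ∧ ∀ f, ‖S f‖ ≤ ‖f‖ := by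
  obtain ⟨S, hS, hSφ, hle, -⟩ := h.exists_unique_extension X hX T.toContinuousLinearMap
  refine ⟨S, hS, hSφ, fun f => S.le_of_opNorm_le_of_le ?_ le_rfl |>.trans_eq (one_mul _)⟩
  exact hle.trans (mul_le_one₀ hX1 (norm_nonneg _) T.norm_toContinuousLinearMap_le)

theorem IsFreePConvex.hom_ext {p : ℝ≥0∞} [Fact (1 ≤ p)] {E : Type u}
    [NormedAddCommGroup E] [NormedSpace ℝ E] {F : Type w} [NormedAddCommGroup F] [NormedSpace ℝ F]
    [Lattice F] {φ : E →ₗᵢ[ℝ] F} (h : IsFreePConvex.{v} p φ) {X : Type v} [NormedAddCommGroup X]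
    [NormedSpace ℝ X] [Lattice X] [IsBanachLattice X] (hX : IsPConvex p X) (T : E →L[ℝ] X)
    {S S' : F →ₗ[ℝ] X} (hS : IsLatticeHom S) (hS' : IsLatticeHom S') (hT : ∀ x, S (φ x) = T x)
    (hT' : ∀ x, S' (φ x) = T x) : S = S' := by
  obtain ⟨R, -, -, -, hR⟩ := h.exists_unique_extension X hX T
  rw [hR S hS hT, hR S' hS' hT']

theorem FreePConvex.existsUnique_isometry (p : ℝ≥0∞) [Fact (1 ≤ p)] (E : Type u)
    [NormedAddCommGroup E] [NormedSpace ℝ E] (G : Type (max u v)) [NormedAddCommGroup G]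
    [NormedSpace ℝ G] [Lattice G] (ψ : E →ₗᵢ[ℝ] G) (hG : IsFreePConvex.{max u v} p ψ) :
    ∃! U : FreePConvex p E ≃ₗᵢ[ℝ] G,
      IsLatticeHom (U.toLinearEquiv : FreePConvex p E →ₗ[ℝ] G) ∧ ∀ x, U (ofₗᵢ p x) = ψ x := by
  have := hG.isBanachLattice
  obtain ⟨S, hS, hSφ, hSle⟩ := (isFreePConvex.{u, max u v} p (E := E)).exists_contraction
    hG.isPConvex hG.pConvexityConst_eq_one.le ψ
  -- The universal property of `G` only tests lattices in the universe of `G`.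
  let V : ULift.{v} (FreePConvex p E) ≃ₗᵢ[ℝ] FreePConvex p E :=
    LinearIsometryEquiv.ulift ℝ (FreePConvex p E)
  have hV : IsLatticeHom (V.toLinearEquiv : ULift.{v} (FreePConvex p E) →ₗ[ℝ] FreePConvex p E) :=
    ⟨fun _ _ => rfl, fun _ _ => rfl⟩
  have : IsBanachLattice (ULift.{v} (FreePConvex p E)) := .of_linearIsometryEquiv hV
  have hconv : PConvexWith p (ULift.{v} (FreePConvex p E)) 1 :=
    .of_linearIsometryEquiv hV (FreePConvex.pConvexWith p E)
  obtain ⟨R, hR, hRψ, hRle⟩ := hG.exists_contraction ⟨1, le_rfl, hconv⟩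
    (csInf_le ⟨1, fun _ h => h.1⟩ ⟨le_rfl, hconv⟩) (V.symm.toLinearIsometry.comp (ofₗᵢ p))
  let Q : G →ₗ[ℝ] FreePConvex p E := (V.toLinearEquiv : _ →ₗ[ℝ] FreePConvex p E) ∘ₗ R
  have hQ : IsLatticeHom Q := hV.comp hR
  have hQψ : ∀ x, Q (ψ x) = of p E x := fun x => congrArg V (hRψ x)
  have hQS : Q ∘ₗ S = LinearMap.id :=
    (hQ.comp hS).eq_of_denseRange (denseRange_eval_of p) ⟨fun _ _ => rfl, fun _ _ => rfl⟩
      fun x => (congrArg Q (hSφ x)).trans (hQψ x)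
  have hSQ : S ∘ₗ Q = LinearMap.id :=
    hG.hom_ext hG.isPConvex ψ.toContinuousLinearMap (hS.comp hQ) ⟨fun _ _ => rfl, fun _ _ => rfl⟩
      (fun x => (congrArg S (hQψ x)).trans (hSφ x)) fun _ => rfl
  refine ⟨⟨LinearEquiv.ofLinearMap S Q hSQ hQS, fun f => (hSle f).antisymm ?_⟩, ⟨?_, hSφ⟩, ?_⟩
  · calc ‖f‖ = ‖Q (S f)‖ := by rw [← LinearMap.comp_apply, hQS]; rfl
      _ ≤ ‖S f‖ := hRle (S f)
  · exact ⟨hS.map_sup, hS.map_inf⟩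
  · rintro U' ⟨hU', hU'φ⟩
    have h : (U'.toLinearEquiv : FreePConvex p E →ₗ[ℝ] G) = S :=
      hU'.eq_of_denseRange (denseRange_eval_of p) hS fun x => (hU'φ x).trans (hSφ x).symm
    exact LinearIsometryEquiv.ext fun f => LinearMap.congr_fun h f

theorem theorem1p1 (p : ℝ≥0∞) [Fact (1 ≤ p)]
    (E : Type u) [NormedAddCommGroup E] [NormedSpace ℝ E] [CompleteSpace E] :
    ∃ (F : Type u) (_ : NormedAddCommGroup F) (_ : NormedSpace ℝ F) (_ : Lattice F)
      (φ : E →ₗᵢ[ℝ] F),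
      IsFreePConvex.{max u v} p φ ∧
      ∀ (G : Type (max u v)) [NormedAddCommGroup G] [NormedSpace ℝ G] [Lattice G]
        (ψ : E →ₗᵢ[ℝ] G), IsFreePConvex.{max u v} p ψ →
        ∃! U : F ≃ₗᵢ[ℝ] G,
          IsLatticeHom (U.toLinearEquiv : F →ₗ[ℝ] G) ∧ ∀ x, U (φ x) = ψ x :=
  ⟨FreePConvex p E, inferInstance, inferInstance, inferInstance, FreePConvex.ofₗᵢ p,
    FreePConvex.isFreePConvex p, fun G _ _ _ ψ hG =>
      FreePConvex.existsUnique_isometry.{u, v} p E G ψ hG⟩
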